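/- Let $G$ be a group. For a set $X$ let $\mathrm{cof}_X$ denote the cofinite topology on $X$. Let $\mathfrak C_G$ be the centralizer topology on $G$, i.e. the initial topology of the family of maps $G\to(G,\mathrm{cof}_G)$, $x\mapsto xax^{-1}$ ($a\in G$), and let $\mathfrak C'_G=\mathfrak C_G\vee\mathrm{cof}_G$ be the coarsest topology on $G$ that is finer than both $\mathfrak C_G$ and $\mathrm{cof}_G$. The group $G$ is called $\mathfrak C'$-cofinite if $\mathfrak C'_G=\mathrm{cof}_G$. Write $[a,b]=aba^{-1}b^{-1}$, and for $x,y\in G$ put $[x,_0y]=x$ and $[x,_{n+1}y]=[[x,_ny],y]$. The set of Engel elements of $G$ is $$L(G)=\{x\in G : \text{for every } g\in G \text{ there is } n\in\mathbb N \text{ with } [x,_n g]=e\},$$ and $G$ is an Engel group if $L(G)=G$. Let also $$L'(G)=\{x\in G : \text{for every } g\in G \text{ there is } n\in\mathbb N \text{ with } [g,_n x]=e\}$$ (so $L(G)$ and $L'(G)$ are the sets of right and of left Engel elements, respectively). Let $Z(G)$ be the center of $G$, and let the Fitting subgroup $F(G)$ be the subgroup of $G$ generated by all nilpotent normal subgroups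 of $G$. **Theorem.** Let $G$ be an infinite non-abelian $\mathfrak C'$-cofinite group. Then $$Z(G)=L(G)=F(G),$$ and also $L'(G)=F(G)$. In particular, $G$ is not an Engel group. -/

import Mathlib

/-- The cofinite topology on `X` (closed sets: `X` and the finite subsets), as a topology on `X`
itself rather than on the type synonym `CofiniteTopology X`. -/
@[reducible] def cofTopology (X : Type*) : TopologicalSpace X :=
  TopologicalSpace.induced (CofiniteTopology.of : X ≃ CofiniteTopology X) inferInstance

/-- The centralizer topology on `G`: the initial topology of the functions `x ↦ x a x⁻¹`, `a ∈ G`,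
regarded as functions from `G` to `G` with the cofinite topology. -/
@[reducible] def centralizerTopology (G : Type*) [Group G] : TopologicalSpace G :=
  ⨅ a : G, TopologicalSpace.induced (fun x : G => x * a * x⁻¹) (cofTopology G)

/-- The coarsest topology finer than both the centralizer topology and the cofinite topology.
In Mathlib's order on topologies `t ≤ t'` means that `t` is finer, so this is `⊓`. -/
@[reducible] def centralizerTopology' (G : Type*) [Group G] : TopologicalSpace G :=
  centralizerTopology G ⊓ cofTopology G

/-- A group is `ℭ'`-cofinite if the topology `centralizerTopology' G` is the cofinite one. -/
def IsCentralizerCofinite (G : Type*) [Group G] : Prop :=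
  centralizerTopology' G = cofTopology G

/-- The iterated commutator `[x,ₙ y]`: `[x,₀ y] = x` and `[x,ₙ₊₁ y] = [[x,ₙ y], y]`, where
`[a, b] = a b a⁻¹ b⁻¹`. -/
def iteratedCommutator {G : Type*} [Group G] (x y : G) : ℕ → G
  | 0 => x
  | n + 1 => iteratedCommutator x y n * y * (iteratedCommutator x y n)⁻¹ * y⁻¹

/-- The elements `x` such that for every `g` some `[x,ₙ g]` is trivial. -/
def engelElements (G : Type*) [Group G] : Set G :=
  {x | ∀ g : G, ∃ n : ℕ, iteratedCommutator x g n = 1}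

/-- The elements `x` such that for every `g` some `[g,ₙ x]` is trivial
(left Engel elements; those of `engelElements` are often called right Engel elements). -/
def leftEngelElements (G : Type*) [Group G] : Set G :=
  {x | ∀ g : G, ∃ n : ℕ, iteratedCommutator g x n = 1}

/-- A group is an Engel group if all its elements are Engel elements. -/
def IsEngelGroup (G : Type*) [Group G] : Prop :=
  engelElements G = Set.univ

/-- The Fitting subgroup: the subgroup generated by all nilpotent normal subgroups. -/
def fittingSubgroup (G : Type*) [Group G] : Subgroup G :=
  sSup {N : Subgroup G | N.Normal ∧ Group.IsNilpotent N}

section IteratedCommutator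

variable {G H : Type*} [Group G] [Group H]

theorem map_iteratedCommutator (f : G →* H) (x y : G) (n : ℕ) :
    f (iteratedCommutator x y n) = iteratedCommutator (f x) (f y) n := by
  induction n with
  | zero => rfl
  | succ n ih => simp [iteratedCommutator, ih]

theorem map_mem_leftEngelElements {f : G →* H} (hf : Function.Surjective f) {x : G}
    (hx : x ∈ leftEngelElements G) : f x ∈ leftEngelElements H := by
  intro h
  obtain ⟨g, rfl⟩ := hf h
  obtain ⟨n, hn⟩ := hx g
  exact ⟨n, by rw [← map_iteratedCommutator, hn, map_one]⟩

theorem conj_mem_leftEngelElements {x : G} (hx : x ∈ leftEngelElements G) (g : G) :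
    g * x * g⁻¹ ∈ leftEngelElements G :=
  map_mem_leftEngelElements (f := (MulAut.conj g).toMonoidHom) (MulAut.conj g).surjective hx

theorem mem_leftEngelElements_of_injective {f : G →* H} (hf : Function.Injective f) {x : G}
    (hx : f x ∈ leftEngelElements H) : x ∈ leftEngelElements G := by
  intro g
  obtain ⟨n, hn⟩ := hx (f g)
  exact ⟨n, hf (by rw [map_iteratedCommutator, hn, map_one])⟩

theorem iteratedCommutator_succ_conj (g x : G) (n : ℕ) :
    iteratedCommutator g x (n + 2) = iteratedCommutator (g * x * g⁻¹) x (n + 1) := by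
  induction n with
  | zero => simp [iteratedCommutator, mul_assoc]
  | succ n ih =>
    rw [iteratedCommutator, ih]
    rfl

theorem iteratedCommutator_succ_eq_one {x y : G} {n : ℕ} (h : iteratedCommutator x y n = 1) :
    iteratedCommutator x y (n + 1) = 1 := by
  simp [iteratedCommutator, h]

theorem conj_mem_engelElements {x : G} (hx : x ∈ engelElements G) (g : G) :
    g * x * g⁻¹ ∈ engelElements G := by
  intro h
  obtain ⟨n, hn⟩ := hx (g⁻¹ * h * g)
  refine ⟨n, ?_⟩
  have := map_iteratedCommutator (MulAut.conj g).toMonoidHom x (g⁻¹ * h * g) n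
  rw [hn, map_one] at this
  simpa [mul_assoc] using this.symm

/-- Right Engel elements are left Engel elements (for the convention `[a, b] = a b a⁻¹ b⁻¹`). -/
theorem engelElements_subset_leftEngelElements : engelElements G ⊆ leftEngelElements G := by
  intro x hx g
  obtain ⟨n, hn⟩ := conj_mem_engelElements hx g x
  exact ⟨n + 2, by rw [iteratedCommutator_succ_conj, iteratedCommutator_succ_eq_one hn]⟩

theorem center_subset_engelElements : (Subgroup.center G : Set G) ⊆ engelElements G := by
  intro x hx g
  refine ⟨1, ?_⟩
  have := Subgroup.mem_center_iff.mp hx g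
  simp [iteratedCommutator, ← this]

theorem iteratedCommutator_mem {K : Subgroup G} {x y : G} (hx : x ∈ K) (hy : y ∈ K) (n : ℕ) :
    iteratedCommutator x y n ∈ K := by
  induction n with
  | zero => exact hx
  | succ n ih => exact K.mul_mem (K.mul_mem (K.mul_mem ih hy) (K.inv_mem ih)) (K.inv_mem hy)

theorem iteratedCommutator_mem_of_normal {K : Subgroup G} [hK : K.Normal] {x : G} (hx : x ∈ K)
    (y : G) (n : ℕ) : iteratedCommutator x y n ∈ K := by
  induction n with
  | zero => exact hx
  | succ n ih =>
    have := K.mul_mem ih (hK.conj_mem _ (K.inv_mem ih) y)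
    simpa [iteratedCommutator, mul_assoc] using this

end IteratedCommutator

section Nilpotent

open Subgroup Group

theorem isNilpotent_of_forall_mul_comm {G : Type*} [Group G] (h : ∀ a b : G, a * b = b * a) :
    IsNilpotent G :=
  letI : CommGroup G := { ‹Group G› with mul_comm := h }
  CommGroup.isNilpotent

theorem isNilpotent_zpowers {G : Type*} [Group G] (g : G) : IsNilpotent (zpowers g) :=
  isNilpotent_of_forall_mul_comm fun a b => by
    obtain ⟨_, m, rfl⟩ := a
    obtain ⟨_, n, rfl⟩ := b
    exact Subtype.ext ((Commute.refl g).zpow_zpow m n)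

/-- If a group is generated by a nontrivial nilpotent normal subgroup `N` and a left Engel element,
then `N` contains a nontrivial element that is central in the whole group. -/
theorem exists_mem_center_of_leftEngel {H : Type*} [Group H] (N : Subgroup H) [N.Normal]
    [IsNilpotent N] [Nontrivial N] {u : H} (hu : u ∈ leftEngelElements H)
    (hgen : N ⊔ zpowers u = ⊤) : ∃ z ∈ N, z ∈ center H ∧ z ≠ 1 := by
  classical
  obtain ⟨⟨a, haN⟩, ha, ha1⟩ := (center N).bot_or_exists_ne_one.resolve_left
    (IsNilpotent.center_ne_bot (G := N))
  set A : Subgroup H := N ⊓ centralizer N with hA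
  have haA : a ∈ A := ⟨haN, fun n hn => congrArg Subtype.val (mem_center_iff.mp ha ⟨n, hn⟩)⟩
  have hEx := hu a
  set k := Nat.find hEx with hk
  have hk0 : k ≠ 0 := fun h => ha1 (Subtype.ext (by
    have := Nat.find_spec hEx
    rw [← hk, h] at this
    exact this))
  obtain ⟨m, hm⟩ := Nat.exists_eq_succ_of_ne_zero hk0
  have hz1 : iteratedCommutator a u m ≠ 1 := Nat.find_min hEx (by omega)
  have hzs : iteratedCommutator a u (m + 1) = 1 := by
    have := Nat.find_spec hEx
    rwa [← hk, hm] at this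
  have hzA := iteratedCommutator_mem_of_normal (K := A) haA u m
  refine ⟨_, hzA.1, ?_, hz1⟩
  have hle : N ⊔ zpowers u ≤ centralizer {iteratedCommutator a u m} := by
    refine sup_le (fun n hn => ?_) ?_
    · rw [mem_centralizer_singleton_iff]
      exact hzA.2 n hn
    · rw [zpowers_le, mem_centralizer_singleton_iff]
      simp only [iteratedCommutator] at hzs
      exact (mul_inv_eq_iff_eq_mul.mp (mul_inv_eq_one.mp hzs)).symm
  rw [hgen] at hle
  exact mem_center_iff.mpr fun g => mem_centralizer_singleton_iff.mp (hle (mem_top g))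

theorem isNilpotent_of_sup_zpowers_leftEngel {H : Type*} [Group H] (N : Subgroup H)
    [hN : N.Normal] [Finite N] [hnil : IsNilpotent N] {u : H} (hu : u ∈ leftEngelElements H)
    (hgen : N ⊔ zpowers u = ⊤) : IsNilpotent H := by
  induction hn : Nat.card N using Nat.strong_induction_on generalizing H with
  | _ n ih =>
    rcases subsingleton_or_nontrivial N with hs | hs
    · rw [N.eq_bot_of_subsingleton, bot_sup_eq] at hgen
      have : IsNilpotent (⊤ : Subgroup H) := by
        rw [← hgen]; exact isNilpotent_zpowers u
      exact isNilpotent_top.mp this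
    · obtain ⟨z, hzN, hz, hz1⟩ := exists_mem_center_of_leftEngel N hu hgen
      apply Group.of_quotient_center_nilpotent
      set f := QuotientGroup.mk' (center H)
      have hf : Function.Surjective f := QuotientGroup.mk'_surjective _
      have : (N.map f).Normal := hN.map f hf
      have : Finite (N.map f) := Set.Finite.image f (Set.toFinite (N : Set H))
      have : IsNilpotent (N.map f) := Group.nilpotent_of_surjective _ (f.subgroupMap_surjective N)
      refine ih _ ?_ (N.map f) (map_mem_leftEngelElements hf hu) ?_ rfl
      · rw [← hn]
        refine lt_of_le_of_ne (Nat.card_le_card_of_surjective _ (f.subgroupMap_surjective N)) ?_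
        intro hcard
        have hb := (Nat.bijective_iff_surjective_and_card _).mpr
          ⟨f.subgroupMap_surjective N, hcard.symm⟩
        have : (⟨z, hzN⟩ : N) = 1 := hb.1 (Subtype.ext (by simpa [f] using hz))
        exact hz1 (congrArg Subtype.val this)
      · rw [← MonoidHom.map_zpowers, ← Subgroup.map_sup, hgen, ← MonoidHom.range_eq_map,
          MonoidHom.range_eq_top.mpr hf]

theorem isNilpotent_closure_insert {G : Type*} [Group G] {P : Set G} {w : G}
    (hP : IsNilpotent (closure P)) (hfin : (closure P : Set G).Finite)
    (hw : w ∈ leftEngelElements G) (hnorm : w ∈ normalizer P) :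
    IsNilpotent (closure (insert w P)) := by
  set H := closure (insert w P) with hH
  have hle : closure P ≤ H := closure_mono (Set.subset_insert _ _)
  have hwH : w ∈ H := subset_closure (Set.mem_insert _ _)
  have hHn : H ≤ normalizer (closure P : Set G) := by
    rw [hH, closure_le]
    rintro y (rfl | hy)
    · exact normalizer_le_normalizer_closure P hnorm
    · exact le_normalizer (subset_closure hy)
  have : ((closure P).subgroupOf H).Normal := (normal_subgroupOf_iff_le_normalizer hle).mpr hHn
  have : Finite (closure P) := hfin
  have : Finite ((closure P).subgroupOf H) :=
    Finite.of_equiv _ (subgroupOfEquivOfLe hle).symm.toEquiv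
  have : IsNilpotent ((closure P).subgroupOf H) :=
    Group.nilpotent_of_mulEquiv (subgroupOfEquivOfLe hle).symm
  refine isNilpotent_of_sup_zpowers_leftEngel ((closure P).subgroupOf H) (u := ⟨w, hwH⟩)
    (mem_leftEngelElements_of_injective (f := H.subtype) H.subtype_injective hw) ?_
  apply map_injective H.subtype_injective
  rw [Subgroup.map_sup, map_subgroupOf_eq_of_le hle, MonoidHom.map_zpowers, ← MonoidHom.range_eq_map,
    range_subtype, subtype_apply]
  change Subgroup.closure P ⊔ zpowers w = H
  rw [hH, Set.insert_eq, Subgroup.closure_union, sup_comm, zpowers_eq_closure]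

theorem exists_mem_normalizer_notMem {G : Type*} [Group G] {H K : Subgroup G} [IsNilpotent H]
    (hlt : K < H) : ∃ g ∈ H, g ∉ K ∧ g ∈ normalizer (K : Set G) := by
  have h := Group.normalizerCondition_of_isNilpotent (G := H) (K.subgroupOf H)
    (lt_top_iff_ne_top.mpr fun h => hlt.not_ge (subgroupOf_eq_top.mp h))
  obtain ⟨g, hg, hgK⟩ := SetLike.exists_of_lt h
  rw [← subgroupOf_normalizer_eq hlt.le] at hg
  exact ⟨g, g.2, hgK, hg⟩

end Nilpotent

section Centralizers

open Subgroup Group Topology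

theorem IsCentralizerCofinite.finite_centralizer {G : Type*} [Group G]
    (hG : IsCentralizerCofinite G) {a : G} (ha : a ∉ center G) :
    (centralizer {a} : Set G).Finite := by
  have hsing : IsClosed[cofTopology G] {a} := by
    rw [isClosed_induced_iff]
    exact ⟨{CofiniteTopology.of a},
      CofiniteTopology.isClosed_iff.mpr (.inr (Set.finite_singleton _)),
      by ext; simp⟩
  have hcl : IsClosed[TopologicalSpace.induced (fun x : G => x * a * x⁻¹) (cofTopology G)]
      (centralizer {a} : Set G) := by
    rw [@isClosed_induced_iff _ _ (cofTopology G)]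
    refine ⟨{a}, hsing, ?_⟩
    ext x
    simp only [Set.mem_preimage, Set.mem_singleton_iff, SetLike.mem_coe,
      mem_centralizer_singleton_iff, mul_inv_eq_iff_eq_mul]
  have hcl' : IsClosed[cofTopology G] (centralizer {a} : Set G) := by
    rw [← show centralizerTopology' G = cofTopology G from hG]
    exact hcl.mono (inf_le_left.trans (iInf_le _ a))
  rw [isClosed_induced_iff] at hcl'
  obtain ⟨t, ht, hta⟩ := hcl'
  rcases CofiniteTopology.isClosed_iff.mp ht with rfl | ht
  · exact absurd (mem_center_iff.mpr fun g => mem_centralizer_singleton_iff.mp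
      (show g ∈ (centralizer {a} : Set G) from hta ▸ trivial)) ha
  · rw [← hta]
    exact ht.preimage CofiniteTopology.of.injective.injOn

/-- If the centralizer of `a` is finite, then conjugating `a` is a finite-to-one map. -/
theorem finite_preimage_conj {G : Type*} [Group G] {a : G}
    (ha : (centralizer {a} : Set G).Finite) {T : Set G} (hT : T.Finite) :
    {g : G | g * a * g⁻¹ ∈ T}.Finite := by
  refine Set.Finite.preimage' (f := fun g : G => g * a * g⁻¹) hT fun b _ => ?_
  rcases Set.eq_empty_or_nonempty ((fun g : G => g * a * g⁻¹) ⁻¹' {b}) with h | ⟨g, hg⟩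
  · rw [h]; exact Set.finite_empty
  · refine (ha.image (g * ·)).subset fun h hh => ⟨g⁻¹ * h, ?_, by simp⟩
    have e : h * a * h⁻¹ = g * a * g⁻¹ := by
      rw [Set.mem_preimage, Set.mem_singleton_iff] at hg hh
      rw [hg, hh]
    rw [SetLike.mem_coe, mem_centralizer_singleton_iff]
    rw [mul_inv_eq_iff_eq_mul] at e
    simp [mul_assoc] at e ⊢
    simp [e]

/-- A group in which every nontrivial element has a finite centralizer. -/
def HasFiniteCentralizers (Q : Type*) [Group Q] : Prop :=
  ∀ a : Q, a ≠ 1 → (centralizer {a} : Set Q).Finite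

theorem IsCentralizerCofinite.finite_center {G : Type*} [Group G]
    (hG : IsCentralizerCofinite G) (hnonab : ¬ ∀ a b : G, a * b = b * a) :
    (center G : Set G).Finite := by
  push Not at hnonab
  obtain ⟨a, b, hab⟩ := hnonab
  exact (hG.finite_centralizer (a := a) fun h => hab (mem_center_iff.mp h b).symm).subset
    (center_le_centralizer _)

theorem IsCentralizerCofinite.hasFiniteCentralizers_quotient {G : Type*} [Group G]
    (hG : IsCentralizerCofinite G) (hZ : (center G : Set G).Finite) :
    HasFiniteCentralizers (G ⧸ center G) := by
  intro a ha
  obtain ⟨g, rfl⟩ := QuotientGroup.mk_surjective a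
  have hg : g ∉ center G := fun h => ha ((QuotientGroup.eq_one_iff g).mpr h)
  refine ((finite_preimage_conj (hG.finite_centralizer hg)
    (hZ.image (g * ·))).image (QuotientGroup.mk (s := center G))).subset fun b hb => ?_
  obtain ⟨h, rfl⟩ := QuotientGroup.mk_surjective b
  refine ⟨h, ⟨g⁻¹ * (h * g * h⁻¹), ?_, by simp⟩, rfl⟩
  rw [SetLike.mem_coe, mem_centralizer_singleton_iff] at hb
  rw [SetLike.mem_coe, ← QuotientGroup.eq_one_iff]
  simp only [QuotientGroup.mk_mul, QuotientGroup.mk_inv]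
  rw [hb]
  simp

theorem infinite_quotient_center {G : Type*} [Group G] [Infinite G]
    (hZ : (center G : Set G).Finite) : Infinite (G ⧸ center G) := by
  by_contra h
  rw [not_infinite_iff_finite] at h
  have : Finite (center G) := hZ
  have := Finite.of_equiv _ (groupEquivQuotientProdSubgroup (s := center G)).symm
  exact not_finite G

end Centralizers

section FiniteCentralizers

open Subgroup Group

variable {Q : Type*} [Group Q]

theorem HasFiniteCentralizers.finite_iUnion (hQ : HasFiniteCentralizers Q) {h : Q} (hh : h ≠ 1) :
    (⋃ z ∈ (centralizer {h} : Set Q) \ {1}, (centralizer {z} : Set Q)).Finite :=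
  ((hQ h hh).subset Set.sdiff_subset).biUnion fun z hz => hQ z hz.2

theorem exists_le_centralizer_of_isNilpotent {H : Subgroup Q} [IsNilpotent H] (hH : H ≠ ⊥) :
    ∃ z ∈ H, z ≠ 1 ∧ H ≤ centralizer {z} := by
  have : Nontrivial H := (nontrivial_iff_ne_bot H).mpr hH
  obtain ⟨⟨z, hzH⟩, hz, hz1⟩ := (center H).bot_or_exists_ne_one.resolve_left
    (IsNilpotent.center_ne_bot (G := H))
  refine ⟨z, hzH, fun h => hz1 (Subtype.ext h), fun y hy => ?_⟩
  rw [mem_centralizer_singleton_iff]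
  exact congrArg Subtype.val (mem_center_iff.mp hz ⟨y, hy⟩)

/-- The nilpotent subgroups containing a given nontrivial element `h` are all contained in
one finite set. -/
theorem subset_iUnion_centralizer_of_isNilpotent {H : Subgroup Q} [IsNilpotent H] {h : Q}
    (hh : h ≠ 1) (hH : h ∈ H) :
    (H : Set Q) ⊆ ⋃ z ∈ (centralizer {h} : Set Q) \ {1}, (centralizer {z} : Set Q) := by
  obtain ⟨z, -, hz1, hz⟩ := exists_le_centralizer_of_isNilpotent (H := H) fun hb =>
    hh (by simpa [hb] using hH)
  refine fun y hy => Set.mem_biUnion (x := z) ⟨?_, hz1⟩ (hz hy)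
  rw [SetLike.mem_coe, mem_centralizer_singleton_iff]
  exact (mem_centralizer_singleton_iff.mp (hz hH)).symm

theorem HasFiniteCentralizers.finite_of_isNilpotent (hQ : HasFiniteCentralizers Q)
    {H : Subgroup Q} [IsNilpotent H] : (H : Set Q).Finite := by
  rcases H.bot_or_exists_ne_one with rfl | ⟨h, hH, hh⟩
  · simp
  · exact (hQ.finite_iUnion hh).subset (subset_iUnion_centralizer_of_isNilpotent hh hH)

theorem HasFiniteCentralizers.eq_bot_of_normal_of_isNilpotent [Infinite Q]
    (hQ : HasFiniteCentralizers Q) {N : Subgroup Q} (hN : N.Normal) [IsNilpotent N] : N = ⊥ := by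
  by_contra hb
  obtain ⟨h, hh, h1⟩ := N.bot_or_exists_ne_one.resolve_left hb
  refine Set.infinite_univ ((finite_preimage_conj (hQ h h1)
    (hQ.finite_of_isNilpotent (H := N))).subset
    fun g _ => ?_)
  exact hN.conj_mem h hh g

/-- A set of conjugates of `x` that generates a nilpotent subgroup. -/
def IsNilpotentConjugates (x : Q) (X : Set Q) : Prop :=
  X ⊆ conjugatesOf x ∧ IsNilpotent (Subgroup.closure X)

theorem conj_mem_conjugatesOf {x y : Q} (hy : y ∈ conjugatesOf x) (g : Q) :
    g * y * g⁻¹ ∈ conjugatesOf x :=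
  IsConj.trans hy (isConj_iff.mpr ⟨g, rfl⟩)

theorem ne_one_of_mem_conjugatesOf {x y : Q} (hx : x ≠ 1) (hy : y ∈ conjugatesOf x) : y ≠ 1 := by
  rintro rfl
  exact hx (isConj_one_left.mp hy)

theorem IsNilpotentConjugates.image_conj {x : Q} {X : Set Q} (hX : IsNilpotentConjugates x X)
    (g : Q) : IsNilpotentConjugates x (MulAut.conj g '' X) := by
  constructor
  · rintro _ ⟨y, hy, rfl⟩
    exact conj_mem_conjugatesOf (hX.1 hy) g
  · have := hX.2
    have e := MonoidHom.map_closure (MulAut.conj g).toMonoidHom X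
    have h2 : IsNilpotent ((Subgroup.closure X).map (MulAut.conj g).toMonoidHom) :=
      Group.nilpotent_of_surjective _ (MonoidHom.subgroupMap_surjective _ _)
    rw [e] at h2
    exact h2

theorem image_conj_inv_image_conj (g : Q) (X : Set Q) :
    MulAut.conj g '' (MulAut.conj g⁻¹ '' X) = X := by
  rw [Set.image_image]
  simp [mul_assoc]

theorem maximal_image_conj {x : Q} {X : Set Q} (hX : Maximal (IsNilpotentConjugates x) X)
    (g : Q) : Maximal (IsNilpotentConjugates x) (MulAut.conj g '' X) := by
  refine ⟨hX.1.image_conj g, fun Y hY hle => ?_⟩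
  have h1 : X ⊆ MulAut.conj g⁻¹ '' Y := by
    have := Set.image_mono (f := MulAut.conj g⁻¹) hle
    have e := image_conj_inv_image_conj g⁻¹ X
    rw [inv_inv] at e
    rwa [e] at this
  have h2 := Set.image_mono (f := MulAut.conj g) (hX.2 (hY.image_conj g⁻¹) h1)
  rwa [image_conj_inv_image_conj] at h2

theorem mem_of_mem_closure_of_maximal {x : Q} {P : Set Q}
    (hP : Maximal (IsNilpotentConjugates x) P) {y : Q} (hy : y ∈ Subgroup.closure P)
    (hyx : y ∈ conjugatesOf x) : y ∈ P := by
  have hsub : P ⊆ (Subgroup.closure P : Set Q) ∩ conjugatesOf x :=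
    fun z hz => ⟨subset_closure hz, hP.1.1 hz⟩
  have hcl : Subgroup.closure ((Subgroup.closure P : Set Q) ∩ conjugatesOf x) =
      Subgroup.closure P :=
    le_antisymm ((Subgroup.closure_le _).mpr Set.inter_subset_left) (Subgroup.closure_mono hsub)
  refine hP.2 (y := (Subgroup.closure P : Set Q) ∩ conjugatesOf x)
    ⟨Set.inter_subset_right, ?_⟩ hsub ⟨hy, hyx⟩
  rw [hcl]
  exact hP.1.2

theorem mem_of_mem_normalizer_of_maximal (hQ : HasFiniteCentralizers Q) {x : Q}
    (hx : x ∈ leftEngelElements Q) {P : Set Q} (hP : Maximal (IsNilpotentConjugates x) P) {w : Q}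
    (hw : w ∈ conjugatesOf x) (hnorm : w ∈ normalizer P) : w ∈ P := by
  have hwE : w ∈ leftEngelElements Q := by
    obtain ⟨c, rfl⟩ := isConj_iff.mp hw
    exact conj_mem_leftEngelElements hx c
  have := hP.1.2
  refine hP.2 (y := insert w P) ⟨Set.insert_subset hw hP.1.1, ?_⟩ (Set.subset_insert _ _)
    (Set.mem_insert _ _)
  exact isNilpotent_closure_insert hP.1.2 hQ.finite_of_isNilpotent hwE hnorm

theorem exists_maximal_superset (hQ : HasFiniteCentralizers Q) {x s : Q} (hx : x ≠ 1)
    (hs : s ∈ conjugatesOf x) : ∃ P, s ∈ P ∧ Maximal (IsNilpotentConjugates x) P := by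
  have hfin : {X : Set Q | IsNilpotentConjugates x X ∧ s ∈ X}.Finite := by
    refine ((hQ.finite_iUnion (ne_one_of_mem_conjugatesOf hx hs)).finite_subsets).subset ?_
    rintro X ⟨hX, hsX⟩
    have := hX.2
    exact subset_closure.trans (subset_iUnion_centralizer_of_isNilpotent
      (ne_one_of_mem_conjugatesOf hx hs) (subset_closure hsX))
  have hsing : IsNilpotentConjugates x {s} := by
    refine ⟨Set.singleton_subset_iff.mpr hs, ?_⟩
    rw [← zpowers_eq_closure]
    exact isNilpotent_zpowers s
  obtain ⟨P, hP⟩ := hfin.exists_maximal ⟨{s}, hsing, rfl⟩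
  exact ⟨P, hP.1.2, hP.1.1, fun Y hY hle => hP.2 ⟨hY, hle hP.1.2⟩ hle⟩

/-- The normalizer condition for sets of conjugates. -/
theorem exists_mem_diff_mem_normalizer (hQ : HasFiniteCentralizers Q) {x : Q} {P I : Set Q}
    (hP : Maximal (IsNilpotentConjugates x) P) (hI : I ⊂ P)
    (hcl : ∀ y ∈ Subgroup.closure I, y ∈ conjugatesOf x → y ∈ I) :
    ∃ u ∈ P, u ∉ I ∧ u ∈ normalizer I := by
  have := hP.1.2
  set H := Subgroup.closure P
  have hfinH : (H : Set Q).Finite := hQ.finite_of_isNilpotent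
  have hfin : {K : Subgroup Q | K ≤ H ∧ (K : Set Q) ∩ conjugatesOf x = I}.Finite := by
    refine Set.Finite.of_finite_image (f := fun K : Subgroup Q => (K : Set Q))
      (hfinH.finite_subsets.subset ?_) SetLike.coe_injective.injOn
    rintro _ ⟨K, hK, rfl⟩
    exact hK.1
  obtain ⟨K, ⟨hKH, hKI⟩, hKmax⟩ := hfin.exists_maximal ⟨Subgroup.closure I,
    Subgroup.closure_mono hI.subset, Set.Subset.antisymm (fun y hy => hcl y hy.1 hy.2)
      fun y hy => ⟨subset_closure hy, hP.1.1 (hI.subset hy)⟩⟩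
  have hne : K ≠ H := by
    rintro rfl
    refine hI.not_subset fun y hy => ?_
    rw [← hKI]
    exact ⟨subset_closure hy, hP.1.1 hy⟩
  obtain ⟨g, hgH, hgK, hgn⟩ := exists_mem_normalizer_notMem (lt_of_le_of_ne hKH hne)
  have hnot : ((H ⊓ normalizer (K : Set Q) : Subgroup Q) : Set Q) ∩ conjugatesOf x ≠ I := fun h =>
    hgK (hKmax ⟨inf_le_left, h⟩ (le_inf hKH le_normalizer) ⟨hgH, hgn⟩)
  obtain ⟨u, ⟨⟨huH, hun⟩, hux⟩, huI⟩ :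
      ∃ u ∈ ((H ⊓ normalizer (K : Set Q) : Subgroup Q) : Set Q) ∩ conjugatesOf x, u ∉ I := by
    by_contra! hcon
    refine hnot (Set.Subset.antisymm hcon fun y hy => ?_)
    rw [← hKI] at hy
    exact ⟨⟨hKH hy.1, le_normalizer hy.1⟩, hy.2⟩
  refine ⟨u, mem_of_mem_closure_of_maximal hP huH hux, huI, ?_⟩
  rw [← hKI, mem_set_normalizer_iff]
  intro h
  refine and_congr (mem_set_normalizer_iff.mp hun h) ⟨fun hh => conj_mem_conjugatesOf hh u,
    fun hh => ?_⟩
  simpa [mul_assoc] using conj_mem_conjugatesOf hh u⁻¹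

/-- The intersection of two distinct maximal nilpotent sets of conjugates of a left Engel element
is properly contained in another such intersection. -/
theorem eq_of_maximal_inter (hQ : HasFiniteCentralizers Q) {x : Q}
    (hx : x ∈ leftEngelElements Q) {P R : Set Q} (hP : Maximal (IsNilpotentConjugates x) P)
    (hR : Maximal (IsNilpotentConjugates x) R)
    (hmax : ∀ P' R', Maximal (IsNilpotentConjugates x) P' → Maximal (IsNilpotentConjugates x) R' →
      P ∩ R ⊂ P' ∩ R' → P' = R') : P = R := by
  by_contra hne
  have hIP : P ∩ R ⊂ P := Set.inter_subset_left.ssubset_of_ne fun h =>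
    hne (hP.eq_of_le hR.1 (Set.inter_eq_left.mp h))
  have hIR : P ∩ R ⊂ R := Set.inter_subset_right.ssubset_of_ne fun h =>
    hne (hR.eq_of_le hP.1 (Set.inter_eq_right.mp h)).symm
  have hcl : ∀ y ∈ Subgroup.closure (P ∩ R), y ∈ conjugatesOf x → y ∈ P ∩ R := fun y hy hyx =>
    ⟨mem_of_mem_closure_of_maximal hP (Subgroup.closure_mono Set.inter_subset_left hy) hyx,
      mem_of_mem_closure_of_maximal hR (Subgroup.closure_mono Set.inter_subset_right hy) hyx⟩
  obtain ⟨u, huP, huI, hun⟩ := exists_mem_diff_mem_normalizer hQ hP hIP hcl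
  obtain ⟨v, hvR, hvI, hvn⟩ := exists_mem_diff_mem_normalizer hQ hR hIR hcl
  have hux := hP.1.1 huP
  have huNP : u ∈ normalizer P := by
    have hle : ∀ y ∈ Subgroup.closure P, ∀ h ∈ P, y * h * y⁻¹ ∈ P := fun y hy h hh =>
      mem_of_mem_closure_of_maximal hP (mul_mem (mul_mem hy (subset_closure hh)) (inv_mem hy))
        (conj_mem_conjugatesOf (hP.1.1 hh) y)
    exact le_set_normalizer_iff.mpr hle (subset_closure huP)
  have hstep : ∀ g ∈ normalizer (P ∩ R), g * u * g⁻¹ ∈ P → g ∈ normalizer P := by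
    intro g hg hgu
    rw [mem_normalizer_iff_conj_image_eq] at hg ⊢
    refine hmax _ _ (maximal_image_conj hP g) hP (Set.ssubset_iff_exists.mpr
      ⟨fun y hy => ⟨?_, hy.1⟩, g * u * g⁻¹, ⟨⟨u, huP, rfl⟩, hgu⟩, fun h => huI ?_⟩)
    · rw [← hg] at hy
      exact Set.image_mono Set.inter_subset_left hy
    · rw [← hg] at h
      obtain ⟨w, hw, hwu⟩ := h
      rwa [← (MulAut.conj g).injective hwu]
  have hdesc : ∀ n, iteratedCommutator v u n ∈ normalizer P → v ∈ normalizer P := by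
    intro n
    induction n with
    | zero => exact id
    | succ n ih =>
      intro h
      have hgn := iteratedCommutator_mem hvn hun n
      refine ih (hstep _ hgn ?_)
      refine mem_of_mem_normalizer_of_maximal hQ hx hP (conj_mem_conjugatesOf hux _) ?_
      simpa [iteratedCommutator] using mul_mem h huNP
  have huE : u ∈ leftEngelElements Q := by
    obtain ⟨c, rfl⟩ := isConj_iff.mp hux
    exact conj_mem_leftEngelElements hx c
  obtain ⟨n, hn⟩ := huE v
  have hvP := hdesc n (hn ▸ one_mem _)
  exact hvI ⟨mem_of_mem_normalizer_of_maximal hQ hx hP (hR.1.1 hvR) hvP, hvR⟩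

theorem eq_of_maximal (hQ : HasFiniteCentralizers Q) {x : Q} (hx1 : x ≠ 1)
    (hx : x ∈ leftEngelElements Q) {P R : Set Q} (hP : Maximal (IsNilpotentConjugates x) P)
    (hR : Maximal (IsNilpotentConjugates x) R) : P = R := by
  by_contra hne
  set 𝓘 : Set (Set Q) := {I | ∃ P R, Maximal (IsNilpotentConjugates x) P ∧
    Maximal (IsNilpotentConjugates x) R ∧ P ≠ R ∧ I = P ∩ R}
  obtain ⟨I, ⟨P', R', hP', hR', hne', rfl⟩, hI⟩ : ∃ I, Maximal (· ∈ 𝓘) I := by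
    by_cases h : ∃ I ∈ 𝓘, I.Nonempty
    · obtain ⟨I, hI, s, hs⟩ := h
      have hsx : s ∈ conjugatesOf x := by
        obtain ⟨P, R, hP, -, -, rfl⟩ := hI
        exact hP.1.1 hs.1
      have hs1 := ne_one_of_mem_conjugatesOf hx1 hsx
      have hfin : {J | J ∈ 𝓘 ∧ s ∈ J}.Finite := by
        refine ((hQ.finite_iUnion hs1).finite_subsets).subset ?_
        rintro _ ⟨⟨P, R, hP, -, -, rfl⟩, hsJ⟩
        have := hP.1.2
        exact Set.inter_subset_left.trans (subset_closure.trans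
          (subset_iUnion_centralizer_of_isNilpotent hs1 (subset_closure hsJ.1)))
      obtain ⟨J, hJ⟩ := hfin.exists_maximal ⟨I, hI, hs⟩
      exact ⟨J, hJ.1.1, fun K hK hle => hJ.2 ⟨hK, hle hJ.1.2⟩ hle⟩
    · push Not at h
      refine ⟨P ∩ R, ⟨P, R, hP, hR, hne, rfl⟩, fun K hK _ => ?_⟩
      rw [h K hK]
      exact Set.empty_subset _
  refine hne' (eq_of_maximal_inter hQ hx hP' hR' fun P'' R'' hP'' hR'' hlt => ?_)
  by_contra hne''
  exact hlt.not_subset (hI ⟨P'', R'', hP'', hR'', hne'', rfl⟩ hlt.subset)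

theorem HasFiniteCentralizers.eq_one_of_leftEngel [Infinite Q] (hQ : HasFiniteCentralizers Q)
    {x : Q} (hx : x ∈ leftEngelElements Q) : x = 1 := by
  by_contra hx1
  obtain ⟨P, hxP, hP⟩ := exists_maximal_superset hQ hx1 (mem_conjugatesOf_self (a := x))
  have hPall : P = conjugatesOf x := by
    refine Set.Subset.antisymm hP.1.1 fun s hs => ?_
    obtain ⟨R, hsR, hR⟩ := exists_maximal_superset hQ hx1 hs
    rwa [eq_of_maximal hQ hx1 hx hP hR]
  have := hP.1.2
  have hnormal : (Subgroup.closure P).Normal := by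
    rw [← normalizer_eq_top_iff, eq_top_iff]
    refine le_trans (fun g _ => ?_) (normalizer_le_normalizer_closure P)
    refine (le_set_normalizer_iff (H := ⊤)).mpr (fun h _ y hy => ?_) (mem_top g)
    rw [hPall] at hy ⊢
    exact conj_mem_conjugatesOf hy h
  have hbot := hQ.eq_bot_of_normal_of_isNilpotent hnormal
  exact hx1 (by simpa [hbot] using (subset_closure hxP : x ∈ Subgroup.closure P))

end FiniteCentralizers

open Subgroup Group

theorem mainTheorem11 (G : Type*) [Group G] (hinf : Infinite G)
    (hnonab : ¬ ∀ a b : G, a * b = b * a) (hcof : IsCentralizerCofinite G) :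
    (Subgroup.center G : Set G) = engelElements G ∧
      engelElements G = (fittingSubgroup G : Set G) ∧
      leftEngelElements G = (fittingSubgroup G : Set G) ∧
      ¬ IsEngelGroup G := by
  have hZ := hcof.finite_center hnonab
  have hQ := hcof.hasFiniteCentralizers_quotient hZ
  have := infinite_quotient_center hZ
  have hsurj : Function.Surjective (QuotientGroup.mk' (center G)) :=
    QuotientGroup.mk'_surjective _
  have hleft : leftEngelElements G ⊆ (center G : Set G) := fun x hx =>
    (QuotientGroup.eq_one_iff x).mp (hQ.eq_one_of_leftEngel (map_mem_leftEngelElements hsurj hx))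
  have hL : (center G : Set G) = engelElements G :=
    center_subset_engelElements.antisymm (engelElements_subset_leftEngelElements.trans hleft)
  have hL' : (center G : Set G) = leftEngelElements G :=
    (center_subset_engelElements.trans engelElements_subset_leftEngelElements).antisymm hleft
  have hF : fittingSubgroup G = center G := by
    apply le_antisymm
    · refine sSup_le ?_
      rintro N ⟨hN, hNnil⟩
      have : IsNilpotent (N.map (QuotientGroup.mk' (center G))) :=
        Group.nilpotent_of_surjective _ (MonoidHom.subgroupMap_surjective _ N)
      have hbot := hQ.eq_bot_of_normal_of_isNilpotent (hN.map _ hsurj)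
      rwa [Subgroup.map_eq_bot_iff, QuotientGroup.ker_mk'] at hbot
    · exact le_sSup ⟨inferInstance, isNilpotent_of_forall_mul_comm fun a b =>
        Subtype.ext (mem_center_iff.mp b.2 a)⟩
  refine ⟨hL, by rw [hF, hL], by rw [hF, hL'], fun h => hnonab fun a b => ?_⟩
  have hb : b ∈ (center G : Set G) := by
    rw [hL, show engelElements G = Set.univ from h]
    trivial
  exact mem_center_iff.mp hb a
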